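/- Let $k$ be a field, $n\ge 1$, and let $M$ be a monomial ideal in the polynomial ring $S=k[x_1,\dots,x_n]$, with minimal generating set $G$ (the unique minimal set of monomials that generates $M$). Suppose that there are integers $\alpha_i\ge 0$ and $\beta_i\ge 1$, for $i=1,\dots,n$, such that $x_1^{\alpha_i}x_i^{\beta_i}\in G$ for every $i=1,\dots,n$. Then the projective dimension of the $S$-module $S/M$ is $\operatorname{pd}(S/M)=n$. -/

import Mathlib

open MvPolynomial CategoryTheory

/-- `G` is the minimal generating set of the monomial ideal `M`: it is a set of monomials (with
coefficient `1`) that generates `M`, and no proper subset of it is such a set. An ideal that has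
such a set is a monomial ideal, and then the set is unique. -/
def IsMinimalMonomialGeneratingSet {k : Type*} [Field k] {σ : Type*}
    (M : Ideal (MvPolynomial σ k)) (G : Set (MvPolynomial σ k)) : Prop :=
  Minimal (fun H : Set (MvPolynomial σ k) =>
    (∀ g ∈ H, ∃ s : σ →₀ ℕ, g = monomial s 1) ∧ Ideal.span H = M) G

-- The bound `pd ≤ n` is Hilbert's syzygy theorem. For the lower bound, a monomial `u ∉ M` with `X i
-- * u ∈ M` for all `i` embeds `k` in `S/M`. The cokernel has `pd ≤ n`, so `pd(S/M) < n` would force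
-- `pd k < n`, contradicting `Ext^n(k, k) ≠ 0`.
--
-- To find `u`, let `X 0 ^ (a + 1)` be the pure power in `G` given by `i = 0`. Minimality gives `α i
-- ≤ a` for `i ≠ 0` and `X 0 ^ a ∉ M`. Among multiples of `X 0 ^ a`, those outside `M` have bounded
-- exponents; a maximal one is `u` (`IsMinimalMonomialGeneratingSet.exists_socle`).

universe u v

/-! ### Hilbert's syzygy theorem. -/

section GlobalDimension

open TensorProduct

theorem shortExact_baseChange {R : Type u} [CommRing R] (A : Type u) [CommRing A] [Algebra R A]
    [Module.Flat R A] {K F M : Type u} [AddCommGroup K] [Module R K] [AddCommGroup F] [Module R F]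
    [AddCommGroup M] [Module R M] {f : K →ₗ[R] F} {g : F →ₗ[R] M} (hfg : Function.Exact f g)
    (hf : Function.Injective f) (hg : Function.Surjective g) :
    (ShortComplex.mk (ModuleCat.ofHom (f.baseChange A)) (ModuleCat.ofHom (g.baseChange A)) (by
      rw [← ModuleCat.ofHom_comp, ← LinearMap.baseChange_comp, hfg.linearMap_comp_eq_zero,
        LinearMap.baseChange_zero, ModuleCat.ofHom_zero])).ShortExact :=
  ModuleCat.shortComplex_shortExact _ (lTensor_exact A hfg hg)
    (Module.Flat.lTensor_preserves_injective_linearMap f hf) (LinearMap.lTensor_surjective A hg)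

/-- Flat base change does not increase the projective dimension. -/
theorem hasProjectiveDimensionLE_baseChange {R : Type u} [CommRing R] (A : Type u) [CommRing A]
    [Algebra R A] [Module.Flat R A] (d : ℕ) (M : Type u) [AddCommGroup M] [Module R M]
    (h : HasProjectiveDimensionLE (ModuleCat.of R M) d) :
    HasProjectiveDimensionLE (ModuleCat.of A (A ⊗[R] M)) d := by
  induction d generalizing M with
  | zero =>
    simp only [HasProjectiveDimensionLE, zero_add] at h ⊢
    rw [← projective_iff_hasProjectiveDimensionLT_one, ← IsProjective.iff_projective] at h ⊢
    infer_instance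
  | succ d ih =>
    obtain ⟨F, _, _, _, p, hp⟩ : ∃ (F : Type u) (_ : AddCommGroup F) (_ : Module R F)
        (_ : Module.Projective R F) (p : F →ₗ[R] M), Function.Surjective p :=
      ⟨M →₀ R, inferInstance, inferInstance, inferInstance, Finsupp.linearCombination R id,
        Finsupp.linearCombination_id_surjective R M⟩
    have hS := LinearMap.shortExact_shortComplexKer hp
    have hK := (hS.hasProjectiveDimensionLT_X₃_iff d
      ((IsProjective.iff_projective (R := R) F).mp inferInstance)).mp h
    have hT := shortExact_baseChange A p.exact_subtype_ker_map p.ker.injective_subtype hp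
    refine (hT.hasProjectiveDimensionLT_X₃_iff d ?_).mpr (ih _ hK)
    rw [← IsProjective.iff_projective]
    infer_instance

section KoszulPolynomial

open Polynomial

variable (R : Type u) [CommRing R] (N : Type u) [AddCommGroup N] [Module R N] [Module R[X] N]
  [IsScalarTower R R[X] N]

/-- The endomorphism `X ⊗ n - 1 ⊗ X n` of `R[X] ⊗ N`, whose cokernel is `N`. -/
noncomputable def tensorXSub : R[X] ⊗[R] N →ₗ[R[X]] R[X] ⊗[R] N :=
  LinearMap.liftBaseChange R[X] ((TensorProduct.mk R R[X] N Polynomial.X) -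
    (TensorProduct.mk R R[X] N 1) ∘ₗ (LinearMap.lsmul R[X] N Polynomial.X).restrictScalars R)

/-- The action map `R[X] ⊗ N → N`. -/
noncomputable def tensorAction : R[X] ⊗[R] N →ₗ[R[X]] N :=
  LinearMap.liftBaseChange R[X] (LinearMap.id : N →ₗ[R] N)

variable {R N}

theorem tensorXSub_tmul (p : R[X]) (n : N) :
    tensorXSub R N (p ⊗ₜ n) = (p * Polynomial.X) ⊗ₜ n - p ⊗ₜ ((Polynomial.X : R[X]) • n) := by
  have h : tensorXSub R N (p ⊗ₜ n) = p • ((Polynomial.X : R[X]) ⊗ₜ[R] n -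
      (1 : R[X]) ⊗ₜ[R] ((Polynomial.X : R[X]) • n)) := by
    rw [tensorXSub, LinearMap.liftBaseChange_tmul]
    rfl
  rw [h, smul_sub, TensorProduct.smul_tmul', TensorProduct.smul_tmul', smul_eq_mul, smul_eq_mul,
    mul_one]

theorem tensorAction_tmul (p : R[X]) (n : N) : tensorAction R N (p ⊗ₜ n) = p • n := by
  simp [tensorAction]

theorem tensorAction_tensorXSub (t : R[X] ⊗[R] N) : tensorAction R N (tensorXSub R N t) = 0 := by
  induction t with
  | zero => simp
  | add x y hx hy => simp [hx, hy]
  | tmul p n => simp [tensorXSub_tmul, tensorAction_tmul, mul_smul]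

/-- Modulo the range, powers of `X` move across the tensor sign one at a time. -/
theorem tmul_sub_one_tmul_mem_range (p : R[X]) (n : N) :
    p ⊗ₜ n - 1 ⊗ₜ (p • n) ∈ (tensorXSub R N).range := by
  induction p using Polynomial.induction_on generalizing n with
  | C a =>
    have : (Polynomial.C a : R[X]) ⊗ₜ[R] n = 1 ⊗ₜ ((Polynomial.C a : R[X]) • n) := by
      rw [← mul_one (Polynomial.C a : R[X]), ← Polynomial.smul_eq_C_mul, smul_tmul, smul_assoc, one_smul]
    simp [this]
  | add p q hp hq =>
    have := add_mem (hp n) (hq n)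
    rwa [sub_add_sub_comm, ← add_tmul, ← tmul_add, ← add_smul] at this
  | monomial m a h =>
    have h1 : tensorXSub R N ((Polynomial.C a * Polynomial.X ^ m) ⊗ₜ n) ∈ (tensorXSub R N).range := ⟨_, rfl⟩
    have := add_mem h1 (h ((Polynomial.X : R[X]) • n))
    rwa [tensorXSub_tmul, sub_add_sub_cancel, smul_smul, mul_assoc, ← pow_succ] at this

theorem sub_one_tmul_mem_range (t : R[X] ⊗[R] N) :
    t - 1 ⊗ₜ tensorAction R N t ∈ (tensorXSub R N).range := by
  induction t with
  | zero => simp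
  | add x y hx hy =>
    have := add_mem hx hy
    rwa [sub_add_sub_comm, ← tmul_add, ← map_add] at this
  | tmul p n =>
    rw [tensorAction_tmul]
    exact tmul_sub_one_tmul_mem_range p n

theorem exact_tensorXSub_tensorAction :
    Function.Exact (tensorXSub R N) (tensorAction R N) := by
  intro t
  refine ⟨fun h => ?_, ?_⟩
  · simpa [h] using sub_one_tmul_mem_range t
  · rintro ⟨s, rfl⟩
    exact tensorAction_tensorXSub s

theorem tensorAction_surjective : Function.Surjective (tensorAction R N) :=
  fun n => ⟨1 ⊗ₜ n, by simp [tensorAction_tmul]⟩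

open PolynomialModule in
theorem coeff_tensorXSub (t : R[X] ⊗[R] N) (i : ℕ) :
    (polynomialTensorProductLEquivPolynomialModule R N (tensorXSub R N t)).coeff (i + 1) =
      (polynomialTensorProductLEquivPolynomialModule R N t).coeff i - (Polynomial.X : R[X]) •
        (polynomialTensorProductLEquivPolynomialModule R N t).coeff (i + 1) := by
  have key : ∀ (p : R[X]) (n : N) (j : ℕ),
      (polynomialTensorProductLEquivPolynomialModule R N (p ⊗ₜ n)).coeff j = p.coeff j • n := by
    intro p n j
    have : polynomialTensorProductLEquivPolynomialModule R N (p ⊗ₜ n) = p • single R 0 n := by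
      simp [polynomialTensorProductLEquivPolynomialModule]
      rfl
    rw [this, smul_single_apply]
    simp
  induction t with
  | zero => simp
  | add x y hx hy => simp only [map_add, PolynomialModule.coeff_add, Finsupp.add_apply, hx, hy, smul_add]; abel
  | tmul p n =>
    have hsub : ∀ a b : PolynomialModule R N, (a - b).coeff = a.coeff - b.coeff :=
      map_sub coeffAddEquiv
    rw [tensorXSub_tmul, map_sub, hsub, Finsupp.sub_apply]
    simp only [key]
    rw [Polynomial.coeff_mul_X, smul_comm]

-- On the kernel, coefficient `i` is `X` times coefficient `i + 1`, so vanishing descends from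
-- beyond the degree.
open PolynomialModule in
theorem tensorXSub_injective : Function.Injective (tensorXSub R N) := by
  rw [injective_iff_map_eq_zero]
  intro t ht
  set e := polynomialTensorProductLEquivPolynomialModule R N
  have hstep : ∀ i, (e t).coeff (i + 1) = 0 → (e t).coeff i = 0 := by
    intro i hi
    have := coeff_tensorXSub t i
    rw [ht] at this
    change (e 0).coeff (i + 1) = (e t).coeff i - (Polynomial.X : R[X]) • (e t).coeff (i + 1) at this
    rw [hi, smul_zero, sub_zero, map_zero] at this
    exact this.symm
  obtain ⟨b, hb⟩ := (e t).coeff.support.exists_nat_subset_range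
  have hlarge : (e t).coeff b = 0 := by
    by_contra h
    simpa using hb (Finsupp.mem_support_iff.mpr h)
  have hall : ∀ i, (e t).coeff i = 0 := by
    intro i
    by_cases hib : i < b
    · exact Nat.decreasingInduction' (P := fun j => (e t).coeff j = 0)
        (fun j _ _ hj => hstep j hj) hib.le hlarge
    · by_contra h
      exact hib (by simpa using hb (Finsupp.mem_support_iff.mpr h))
  apply e.injective
  rw [map_zero]
  exact PolynomialModule.coeff_injective (Finsupp.ext hall)

/-- In `0 → R[X] ⊗ N → R[X] ⊗ N → N → 0` the first two terms have dimension at most `d` by flat base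
change. -/
theorem hasProjectiveDimensionLE_polynomial_succ (d : ℕ)
    (h : ∀ M : ModuleCat.{u} R, HasProjectiveDimensionLE M d) (N : ModuleCat.{u} R[X]) :
    HasProjectiveDimensionLE N (d + 1) := by
  let : Module R N := Module.compHom N (Polynomial.C : R →+* R[X])
  have : IsScalarTower R R[X] N := ⟨fun r p n => by
    rw [Polynomial.smul_eq_C_mul, mul_smul]
    rfl⟩
  have hB := hasProjectiveDimensionLE_baseChange R[X] d N (h (ModuleCat.of R N))
  have hT : (ShortComplex.mk (ModuleCat.ofHom (tensorXSub R N))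
      (ModuleCat.ofHom (tensorAction R N)) 
        (ModuleCat.hom_ext (LinearMap.ext tensorAction_tensorXSub))).ShortExact :=
    ModuleCat.shortComplex_shortExact _ exact_tensorXSub_tensorAction tensorXSub_injective
      tensorAction_surjective
  exact hT.hasProjectiveDimensionLT_X₃ (d + 1) hB (hasProjectiveDimensionLT_of_ge _ (d + 1) _ (by lia))

end KoszulPolynomial

attribute [local instance] RingHomInvPair.of_ringEquiv in
theorem hasProjectiveDimensionLE_of_ringEquiv {R S : Type u} [CommRing R] [CommRing S]
    (e : R ≃+* S) (d : ℕ) (h : ∀ M : ModuleCat.{u} R, HasProjectiveDimensionLE M d)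
    (N : ModuleCat.{u} S) : HasProjectiveDimensionLE N d := by
  let : Module R N := Module.compHom N (e : R →+* S)
  have := h (ModuleCat.of R N)
  let e' : ModuleCat.of R N ≃ₛₗ[RingHomClass.toRingHom e] N :=
    { AddEquiv.refl N with map_smul' := fun _ _ => rfl }
  exact ModuleCat.hasProjectiveDimensionLE_of_semiLinearEquiv e e' d

/-- Hilbert's syzygy theorem. -/
theorem hasProjectiveDimensionLE_mvPolynomial (k : Type u) [Field k] (n : ℕ)
    (N : ModuleCat.{u} (MvPolynomial (Fin n) k)) : HasProjectiveDimensionLE N n := by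
  induction n with
  | zero =>
    refine hasProjectiveDimensionLE_of_ringEquiv (isEmptyRingEquiv k (Fin 0)).symm 0 ?_ N
    intro M
    rw [← projective_iff_hasProjectiveDimensionLE_zero, ← IsProjective.iff_projective]
    have : Module.Free k M := Module.Free.of_divisionRing k M
    exact Module.Projective.of_free
  | succ n ih =>
    exact hasProjectiveDimensionLE_of_ringEquiv (finSuccEquiv k n).symm.toRingEquiv (n + 1)
      (hasProjectiveDimensionLE_polynomial_succ n ih) N

end GlobalDimension

/-! ### Nonvanishing of `Ext` along the Koszul filtration by variables. -/

section ExtResidueField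

open Abelian

/-- If `x` is regular on `M` and kills `K`, then a nonzero class in `Ext i M K` has a nonzero image
in `Ext (i + 1) (M / x M) K`. -/
theorem exists_ext_ne_zero_succ {R : Type u} [CommRing R] {S : ShortComplex (ModuleCat.{u} R)}
    (hS : S.ShortExact) (K : ModuleCat.{u} R) (x : R) (hK : ∀ a : K, x • a = 0) (i : ℕ)
    (hf : ∃ φ : S.X₁ ⟶ S.X₂, S.f = x • φ)
    (h : ∃ e : Ext S.X₁ K i, e ≠ 0) : ∃ e : Ext S.X₃ K (i + 1), e ≠ 0 := by
  obtain ⟨e, he⟩ := h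
  obtain ⟨φ, hφ⟩ := hf
  refine ⟨hS.extClass.comp e (add_comm 1 i), fun h0 => he ?_⟩
  -- By exactness the class factors through `S.f = x • φ`; the scalar `x` then moves to `K`, where
  -- it acts as zero.
  obtain ⟨y, rfl⟩ := Ext.contravariant_sequence_exact₁ hS K e (add_comm 1 i) h0
  have hx : x • 𝟙 K = 0 := by
    ext a
    exact hK a
  rw [hφ, Ext.mk₀_smul, Ext.smul_comp, Ext.smul_eq_comp_mk₀, hx, Ext.mk₀_zero, Ext.comp_zero]

variable {k : Type u} {σ : Type v} [Field k]

theorem X_mul_mem_span_X_image_iff {s : Set σ} {j : σ} (hj : j ∉ s) (p : MvPolynomial σ k) :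
    X j * p ∈ Ideal.span (X '' s : Set (MvPolynomial σ k)) ↔
      p ∈ Ideal.span (X '' s : Set (MvPolynomial σ k)) := by
  refine ⟨fun h => ?_, fun h => Ideal.mul_mem_left _ _ h⟩
  rw [mem_ideal_span_X_image] at h ⊢
  intro m hm
  obtain ⟨i, his, hi⟩ := h (Finsupp.single j 1 + m) (by
    rw [mem_support_iff, coeff_X_mul]
    exact mem_support_iff.mp hm)
  refine ⟨i, his, ?_⟩
  have hji : j ≠ i := fun h => hj (h ▸ his)
  simpa [Finsupp.single_apply, hji] using hi

variable (k) in
theorem shortExact_quotient_span_X {s : Set σ} {j : σ} (hj : j ∉ s) :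
    ∃ (S : ShortComplex (ModuleCat.{max u v} (MvPolynomial σ k))), S.ShortExact ∧
      S.X₁ = ModuleCat.of _ (MvPolynomial σ k ⧸ Ideal.span (X '' s : Set (MvPolynomial σ k))) ∧
      S.X₃ = ModuleCat.of _
        (MvPolynomial σ k ⧸ Ideal.span (X '' (insert j s) : Set (MvPolynomial σ k))) ∧
      ∃ φ : S.X₁ ⟶ S.X₂, S.f = (X j : MvPolynomial σ k) • φ := by
  set I := Ideal.span (X '' s : Set (MvPolynomial σ k)) with hI
  set J := Ideal.span (X '' (insert j s) : Set (MvPolynomial σ k)) with hJ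
  have hIJ : I ≤ J := Ideal.span_mono (Set.image_mono (Set.subset_insert _ _))
  have hXJ : (X j : MvPolynomial σ k) ∈ J := Ideal.subset_span ⟨j, Set.mem_insert _ _, rfl⟩
  let f := LinearMap.lsmul (MvPolynomial σ k) (MvPolynomial σ k ⧸ I) (X j)
  let g := Submodule.factor hIJ
  have hfg : ∀ x, g (f x) = 0 := by
    intro x
    obtain ⟨p, rfl⟩ := Submodule.Quotient.mk_surjective _ x
    exact (Submodule.Quotient.mk_eq_zero J).mpr (J.mul_mem_right p hXJ)
  refine ⟨ShortComplex.mk (ModuleCat.ofHom f) (ModuleCat.ofHom g) (ModuleCat.hom_ext (LinearMap.ext hfg)),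
    ModuleCat.shortComplex_shortExact _ ?_ ?_ ?_, rfl, rfl, 𝟙 _, rfl⟩
  · intro y
    refine ⟨fun hy => ?_, ?_⟩
    · obtain ⟨p, rfl⟩ := Submodule.Quotient.mk_surjective _ y
      have hp : p ∈ J := (Submodule.Quotient.mk_eq_zero J).mp hy
      rw [hJ, Set.image_insert_eq, Ideal.mem_span_insert] at hp
      obtain ⟨a, z, hz, rfl⟩ := hp
      refine ⟨Submodule.Quotient.mk a, ?_⟩
      refine (Submodule.Quotient.eq I).mpr ?_
      have : (X j : MvPolynomial σ k) • a - (a * X j + z) = -z := by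
        rw [smul_eq_mul]; ring
      rw [this]
      exact neg_mem hz
    · rintro ⟨x, rfl⟩
      exact hfg x
  · refine (injective_iff_map_eq_zero f).mpr fun x hx => ?_
    obtain ⟨p, rfl⟩ := Submodule.Quotient.mk_surjective _ x
    refine (Submodule.Quotient.mk_eq_zero I).mpr ?_
    exact (X_mul_mem_span_X_image_iff hj p).mp ((Submodule.Quotient.mk_eq_zero I).mp hx)
  · exact Submodule.factor_surjective hIJ

/-- Each variable is regular modulo the others, so adjoining it raises the `Ext` degree by one,
starting from a nonzero map `S → K`. -/
theorem exists_ext_quotient_span_X_ne_zero (K : ModuleCat.{max u v} (MvPolynomial σ k)) [Nontrivial K]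
    (hK : ∀ (i : σ) (a : K), (X i : MvPolynomial σ k) • a = 0) (s : Finset σ) :
    ∃ e : Ext (ModuleCat.of (MvPolynomial σ k)
      (MvPolynomial σ k ⧸ Ideal.span (X '' (s : Set σ) : Set (MvPolynomial σ k)))) K s.card,
      e ≠ 0 := by
  classical
  induction s using Finset.induction_on with
  | empty =>
    obtain ⟨a, ha⟩ := exists_ne (0 : K)
    have hle : Ideal.span (X '' ((∅ : Finset σ) : Set σ) : Set (MvPolynomial σ k)) ≤
        (LinearMap.toSpanSingleton (MvPolynomial σ k) K a).ker := by simp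
    refine ⟨Ext.mk₀ (ModuleCat.ofHom (Submodule.liftQ _ _ hle)), fun h => ha ?_⟩
    replace h := (Ext.mk₀_eq_zero_iff _).mp h
    have h1 := congr(($h).hom (Submodule.Quotient.mk 1))
    change (1 : MvPolynomial σ k) • a = 0 at h1
    rwa [one_smul] at h1
  | insert j s hj ih =>
    obtain ⟨S, hS, h₁, h₃, hφ⟩ := shortExact_quotient_span_X k (s := (s : Set σ)) (j := j) (by simpa)
    rw [Finset.card_insert_of_notMem hj, Finset.coe_insert, ← h₃]
    rw [← h₁] at ih
    exact exists_ext_ne_zero_succ hS K (X j) (hK j) _ hφ ih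

end ExtResidueField

/-! ### A socle element embeds the residue field. -/

section Socle

theorem exists_shortExact_of_socle {k : Type u} {σ : Type v} [Field k] (M : Ideal (MvPolynomial σ k))
    (u : MvPolynomial σ k) (hu : u ∉ M) (hX : ∀ i, X i * u ∈ M) :
    ∃ S : ShortComplex (ModuleCat.{max u v} (MvPolynomial σ k)), S.ShortExact ∧
      S.X₁ = ModuleCat.of _ (MvPolynomial σ k ⧸ idealOfVars σ k) ∧
      S.X₂ = ModuleCat.of _ (MvPolynomial σ k ⧸ M) := by
  let f := LinearMap.toSpanSingleton (MvPolynomial σ k) (MvPolynomial σ k ⧸ M)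
    (Submodule.Quotient.mk u)
  have hf : ∀ p, f p = 0 ↔ p * u ∈ M := fun p => Submodule.Quotient.mk_eq_zero M
  have hle : idealOfVars σ k ≤ f.ker := by
    rw [Ideal.span_le]
    rintro _ ⟨i, rfl⟩
    exact (hf _).mpr (hX i)
  -- If `p` has nonzero constant term `c`, then `p * u ∈ M` gives `c * u ∈ M`, hence `u ∈ M`.
  have hge : ∀ p, f p = 0 → p ∈ idealOfVars σ k := by
    intro p hp
    by_contra hpm
    have hc : p - C (constantCoeff p) ∈ idealOfVars σ k := by
      rw [idealOfVars, ← Set.image_univ, mem_ideal_span_X_image]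
      intro m hm
      by_contra! h0
      have : m = 0 := Finsupp.ext fun i => h0 i (Set.mem_univ i)
      subst this
      simp [constantCoeff_eq] at hm
    have hc0 : constantCoeff p ≠ 0 := fun h => hpm (by simpa [h] using hc)
    have h1 := sub_mem ((hf p).mp hp) ((hf _).mp (hle hc))
    rw [← sub_mul, sub_sub_cancel] at h1
    have h2 := M.mul_mem_left (C (constantCoeff p)⁻¹) h1
    rw [← mul_assoc, ← C_mul, inv_mul_cancel₀ hc0, C_1, one_mul] at h2
    exact hu h2
  let g := (idealOfVars σ k).liftQ f hle
  have hg : Function.Injective g := by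
    refine (injective_iff_map_eq_zero g).mpr fun x hx => ?_
    obtain ⟨p, rfl⟩ := Submodule.Quotient.mk_surjective _ x
    exact (Submodule.Quotient.mk_eq_zero _).mpr (hge p hx)
  exact ⟨ShortComplex.mk (ModuleCat.ofHom g) (ModuleCat.ofHom g.range.mkQ)
    (ModuleCat.hom_ext g.range_mkQ_comp), ModuleCat.shortComplex_shortExact _
      (LinearMap.exact_map_mkQ_range g) hg g.range.mkQ_surjective, rfl, rfl⟩

theorem one_notMem_idealOfVars (k σ : Type*) [Field k] :
    (1 : MvPolynomial σ k) ∉ idealOfVars σ k := by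
  rw [idealOfVars, ← Set.image_univ, mem_ideal_span_X_image]
  simp

end Socle

/-! ### Constructing the socle monomial. -/

section MonomialIdeal

variable {k σ : Type*} [Field k] {M : Ideal (MvPolynomial σ k)} {G : Set (MvPolynomial σ k)}

theorem IsMinimalMonomialGeneratingSet.eq_of_dvd (hG : IsMinimalMonomialGeneratingSet M G)
    {g h : MvPolynomial σ k} (hg : g ∈ G) (hh : h ∈ G) (hgh : g ∣ h) : g = h := by
  by_contra hne
  have hspan : Ideal.span (G \ {h}) = M := by
    rw [← hG.prop.2]
    refine le_antisymm (Ideal.span_mono Set.sdiff_subset) (Ideal.span_le.mpr fun x hx => ?_)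
    by_cases hxh : x = h
    · subst hxh
      exact Ideal.mem_of_dvd _ hgh (Ideal.subset_span ⟨hg, hne⟩)
    · exact Ideal.subset_span ⟨hx, hxh⟩
  have := hG.le_of_le ⟨fun x hx => hG.prop.1 x hx.1, hspan⟩ Set.sdiff_subset hh
  exact this.2 rfl

open Classical in
theorem IsMinimalMonomialGeneratingSet.exists_dvd (hG : IsMinimalMonomialGeneratingSet M G)
    {s : σ →₀ ℕ} (hs : monomial s (1 : k) ∈ M) : ∃ g ∈ G, g ∣ monomial s 1 := by
  have hGE : G = (fun t => monomial t (1 : k)) '' {t | monomial t (1 : k) ∈ G} := by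
    ext g
    refine ⟨fun hg => ?_, ?_⟩
    · obtain ⟨t, rfl⟩ := hG.prop.1 g hg
      exact ⟨t, hg, rfl⟩
    · rintro ⟨t, ht, rfl⟩
      exact ht
  rw [← hG.prop.2, hGE, mem_ideal_span_monomial_image] at hs
  obtain ⟨t, ht, hts⟩ := hs s (by rw [mem_support_iff, coeff_monomial, if_pos rfl]; exact one_ne_zero)
  exact ⟨_, ht, monomial_dvd_monomial.mpr ⟨Or.inr hts, dvd_rfl⟩⟩

/-- If `M` has generators `x₁ ^ αᵢ * xᵢ ^ βᵢ` in its minimal generating set for all `i`, there is a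
monomial outside `M` that all variables multiply into `M`. -/
theorem IsMinimalMonomialGeneratingSet.exists_socle {n : ℕ} [NeZero n]
    {M : Ideal (MvPolynomial (Fin n) k)} {G : Set (MvPolynomial (Fin n) k)}
    (hG : IsMinimalMonomialGeneratingSet M G) (α β : Fin n → ℕ) (hβ : ∀ i, 1 ≤ β i)
    (hmem : ∀ i, (X 0 : MvPolynomial (Fin n) k) ^ α i * X i ^ β i ∈ G) :
    ∃ u, u ∉ M ∧ ∀ i, X i * u ∈ M := by
  obtain ⟨a, ha⟩ : ∃ a, α 0 + β 0 = a + 1 := ⟨α 0 + β 0 - 1, by have := hβ 0; lia⟩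
  have hGM : ∀ g ∈ G, g ∈ M := fun g hg => hG.prop.2 ▸ Ideal.subset_span hg
  have h0 : (X 0 : MvPolynomial (Fin n) k) ^ (a + 1) ∈ G := by
    rw [← ha, pow_add]
    exact hmem 0
  have hmon : ∀ i, (X 0 : MvPolynomial (Fin n) k) ^ α i * X i ^ β i =
      monomial (Finsupp.single 0 (α i) + Finsupp.single i (β i)) 1 := by
    intro i
    rw [X_pow_eq_monomial, X_pow_eq_monomial, monomial_mul, one_mul]
  have hdvd : ∀ {s t : Fin n →₀ ℕ}, s ≤ t → monomial s (1 : k) ∣ monomial t 1 :=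
    fun h => monomial_dvd_monomial.mpr ⟨Or.inr h, dvd_rfl⟩
  have hle : ∀ {s t : Fin n →₀ ℕ}, monomial s (1 : k) ∣ monomial t 1 → s ≤ t :=
    fun h => (monomial_dvd_monomial.mp h).1.resolve_left one_ne_zero
  -- Otherwise the pure power divides, hence equals, a generator involving `X i`.
  have hα : ∀ i, i ≠ 0 → α i ≤ a := by
    intro i hi
    by_contra hlt
    have hd : (X 0 : MvPolynomial (Fin n) k) ^ (a + 1) ∣ X 0 ^ α i * X i ^ β i :=
      (pow_dvd_pow _ (by lia)).mul_right _
    have heq := hG.eq_of_dvd h0 (hmem i) hd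
    rw [hmon, X_pow_eq_monomial] at heq
    have := DFunLike.congr_fun (monomial_left_injective one_ne_zero heq) i
    have hb := hβ i
    simp [hi.symm] at this
    lia
  have hstart : monomial (Finsupp.single 0 a) (1 : k) ∉ M := by
    intro h
    obtain ⟨g, hg, hga⟩ := hG.exists_dvd h
    rw [← X_pow_eq_monomial] at hga
    have heq := hG.eq_of_dvd hg h0 (hga.trans (pow_dvd_pow _ (Nat.le_succ a)))
    rw [heq, X_pow_eq_monomial, X_pow_eq_monomial] at hga
    have := hle hga 0
    simp at this
  -- Requiring `X 0 ^ a` to divide makes the factor `X 0 ^ α i` automatic for `i ≠ 0`, so only the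
  -- exponent of `X i` decides divisibility by that generator.
  let A : Set (Fin n →₀ ℕ) := {e | Finsupp.single 0 a ≤ e ∧ monomial e (1 : k) ∉ M}
  have hfin : A.Finite := by
    refine (Set.finite_Iic (Finsupp.single 0 a + Finsupp.equivFunOnFinite.symm β)).subset ?_
    rintro e ⟨hae, he⟩ i
    by_contra hlt
    apply he
    have hbound : a + β i ≤ e i ∨ (i ≠ 0 ∧ β i ≤ e i) := by
      by_cases hi : i = 0
      · subst hi
        simp at hlt
        lia
      · right
        simp [Ne.symm hi] at hlt
        exact ⟨hi, by lia⟩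
    have ha0 : a ≤ e 0 := by simpa using hae 0
    by_cases hi : i = 0
    · subst hi
      refine M.mem_of_dvd ?_ (hGM _ h0)
      rw [X_pow_eq_monomial]
      refine hdvd ((Finsupp.single_le_iff).mpr ?_)
      have := hβ 0
      simp at hbound
      lia
    · refine M.mem_of_dvd ?_ (hGM _ (hmem i))
      rw [hmon]
      refine hdvd fun j => ?_
      have := hα i hi
      by_cases hj0 : j = 0
      · subst hj0
        simp [hi]
        lia
      · by_cases hji : j = i
        · subst hji
          simp [Ne.symm hi]
          lia
        · simp [Ne.symm hj0, Ne.symm hji]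
  obtain ⟨e, heA, hmax⟩ := hfin.exists_maximal ⟨_, le_rfl, hstart⟩
  refine ⟨monomial e 1, heA.2, fun i => ?_⟩
  by_contra h
  have hX : (X i : MvPolynomial (Fin n) k) * monomial e 1 =
      monomial (Finsupp.single i 1 + e) 1 := by
    rw [X, monomial_mul, one_mul]
  rw [hX] at h
  have := hmax (y := Finsupp.single i 1 + e) ⟨heA.1.trans le_add_self, h⟩ le_add_self i
  simp at this

end MonomialIdeal

theorem mainTheorem9 {k : Type*} [Field k] (n : ℕ) [NeZero n]
    (M : Ideal (MvPolynomial (Fin n) k)) (G : Set (MvPolynomial (Fin n) k))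
    (hG : IsMinimalMonomialGeneratingSet M G)
    (α β : Fin n → ℕ) (hβ : ∀ i, 1 ≤ β i)
    (hmem : ∀ i, (X 0 : MvPolynomial (Fin n) k) ^ α i * X i ^ β i ∈ G) :
    projectiveDimension
      (ModuleCat.of (MvPolynomial (Fin n) k) (MvPolynomial (Fin n) k ⧸ M)) = n := by
  refine le_antisymm ((projectiveDimension_le_iff _ n).mpr
    (hasProjectiveDimensionLE_mvPolynomial k n _)) ?_
  rw [projectiveDimension_ge_iff]
  intro h
  obtain ⟨u, hu, hX⟩ := hG.exists_socle α β hβ hmem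
  obtain ⟨S, hS, h₁, h₂⟩ := exists_shortExact_of_socle M u hu hX
  rw [← h₂] at h
  -- The cokernel may have dimension `n`: the long exact sequence shifts its degree by one.
  have hK := hS.hasProjectiveDimensionLT_X₁ n h (hasProjectiveDimensionLE_mvPolynomial k n _)
  rw [h₁] at hK
  have : Nontrivial (MvPolynomial (Fin n) k ⧸ idealOfVars (Fin n) k) :=
    Ideal.Quotient.nontrivial_iff.mpr
      ((Ideal.ne_top_iff_one _).mpr (one_notMem_idealOfVars k (Fin n)))
  have hann : ∀ (i : Fin n) (a : MvPolynomial (Fin n) k ⧸ idealOfVars (Fin n) k),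
      (X i : MvPolynomial (Fin n) k) • a = 0 := by
    intro i a
    obtain ⟨p, rfl⟩ := Submodule.Quotient.mk_surjective _ a
    exact (Submodule.Quotient.mk_eq_zero _).mpr
      (Ideal.mul_mem_right _ _ (Ideal.subset_span ⟨i, rfl⟩))
  have hext := exists_ext_quotient_span_X_ne_zero
    (ModuleCat.of _ (MvPolynomial (Fin n) k ⧸ idealOfVars (Fin n) k)) hann Finset.univ
  rw [Finset.coe_univ, Set.image_univ, Finset.card_univ, Fintype.card_fin] at hext
  obtain ⟨e, he⟩ := hext
  exact he (e.eq_zero_of_hasProjectiveDimensionLT n le_rfl)
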